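/- Let $n\ge 1$, $s\in\mathbb R$ and $1<p\le\infty$. Let $\varrho,\varphi\in C^\infty(\mathbb R^n)$ be nonnegative radial functions, supported in $\{|\xi|\le \frac43\}$ and $\{\frac34\le|\xi|\le\frac83\}$ respectively, such that $\varrho(\xi)+\sum_{j\ge 0}\varphi(2^{-j}\xi)=1$ for all $\xi$ and $\sum_{j\in\mathbb Z}\varphi(2^{-j}\xi)=1$ for all $\xi\neq0$. Write $\mathcal S'$ for the (complex) tempered distributions on $\mathbb R^n$ and $\mathcal P$ for the polynomials. For $f\in\mathcal S'/\mathcal P$ let $\dot\Delta_jf=\varphi(2^{-j}D)f=\mathcal F^{-1}(\varphi(2^{-j}\cdot)\hat f)$, $j\in\mathbb Z$ (these are smooth functions), and let $\Lambda^sf=(-\Delta)^{s/2}f\in\mathcal S'/\mathcal P$ be given by $\widehat{\Lambda^sf}(\xi)=|\xi|^s\hat f(\xi)$ on $\mathbb R^n\setminus\{0\}$. For a measurable function $u$ put $$\|u\|_{L^{p,\infty}}=\sup_{t>0}t^{1/p}u^*(t),\qquad u^*(t)=\inf\{\alpha>0:|\{x:|u(x)|>\alpha\}|\le t\},$$ with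 $1/\infty=0$, and let $$\|f\|_{\dot B^s_{p,\infty,\infty}}=\sup_{j\in\mathbb Z}2^{js}\|\dot\Delta_jf\|_{L^{p,\infty}},\qquad \|f\|_{\dot F^s_{p,\infty,\infty}}=\Big\|\sup_{j\in\mathbb Z}2^{js}|\dot\Delta_jf|\Big\|_{L^{p,\infty}},\qquad \|f\|_{\dot H^s_{p,\infty}}=\|\Lambda^sf\|_{L^{p,\infty}},$$ where $\|\Lambda^sf\|_{L^{p,\infty}}$ is the infimum of $\|g\|_{L^{p,\infty}}$ over all functions $g$ that represent the class $\Lambda^sf$ modulo $\mathcal P$ (and $\infty$ if there is none). Then there is a constant $C>0$, depending only on $n$, $s$, $p$ and $\varphi$, such that for all $f\in\mathcal S'/\mathcal P$ (in particular for all $f$ with $\|f\|_{\dot H^s_{p,\infty}}<\infty$), as an inequality in $[0,\infty]$, $$\|f\|_{\dot B^s_{p,\infty,\infty}}\le\|f\|_{\dot F^s_{p,\infty,\infty}}\le C\,\|f\|_{\dot H^s_{p,\infty}}.$$ -/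

import Mathlib

open MeasureTheory FourierTransform
open scoped SchwartzMap ENNReal NNReal ContDiff

noncomputable section

namespace LorentzLP

/-- The space `ℝⁿ` with its Euclidean norm and Lebesgue measure. -/
abbrev Rn (n : ℕ) := EuclideanSpace ℝ (Fin n)

/-! ### Weak Lorentz quasi-norms -/

section Lorentz

variable {n : ℕ}

/-- The distribution function `α ↦ |{x : u x > α}|` of a function `u : ℝⁿ → [0, ∞]`
(for a complex function `g` it is applied to `u = |g|`). -/
def distributionFunction (u : Rn n → ℝ≥0∞) (α : ℝ≥0) : ℝ≥0∞ :=
  volume {x | (α : ℝ≥0∞) < u x}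

/-- The decreasing rearrangement `u^*(t) = inf {α > 0 : |{u > α}| ≤ t}`, with `inf ∅ = ∞`. -/
def decreasingRearrangement (u : Rn n → ℝ≥0∞) (t : ℝ≥0) : ℝ≥0∞ :=
  ⨅ (α : ℝ≥0) (_ : 0 < α) (_ : distributionFunction u α ≤ t), (α : ℝ≥0∞)

/-- The Lorentz quasi-norm `‖u‖_{L^{p,∞}} = sup_{t > 0} t^{1/p} u^*(t)`, where `1/∞ = 0`. -/
def weakLorentzNorm (p : ℝ≥0∞) (u : Rn n → ℝ≥0∞) : ℝ≥0∞ :=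
  ⨆ (t : ℝ≥0) (_ : 0 < t), (t : ℝ≥0∞) ^ (p⁻¹).toReal * decreasingRearrangement u t

/-- The tempered distribution `T` is (integration against) the function `g`. Such a `g` is
locally integrable, and unique up to equality almost everywhere. -/
def IsRepresentedBy (T : 𝓢'(Rn n, ℂ)) (g : Rn n → ℂ) : Prop :=
  ∀ ψ : 𝓢(Rn n, ℂ), Integrable (fun x ↦ ψ x * g x) ∧ T ψ = ∫ x, ψ x * g x

/-- The `L^{p,∞}` quasi-norm of a tempered distribution: that of the function which represents it
(the infimum runs over the versions of one function, which all give the same value),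
and `∞` if the distribution is not a function. -/
def distWeakLorentzNorm (p : ℝ≥0∞) (T : 𝓢'(Rn n, ℂ)) : ℝ≥0∞ :=
  ⨅ (g : Rn n → ℂ) (_ : IsRepresentedBy T g), weakLorentzNorm p (fun x ↦ ‖g x‖ₑ)

end Lorentz

/-! ### Tempered distributions modulo polynomials -/

section Polynomials

variable {n : ℕ}

/-- The function on `ℝⁿ` given by a complex polynomial in the coordinates. -/
def polyFun (P : MvPolynomial (Fin n) ℂ) (x : Rn n) : ℂ :=
  MvPolynomial.eval (fun i ↦ (x i : ℂ)) P

theorem hasTemperateGrowth_coord (i : Fin n) :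
    Function.HasTemperateGrowth (fun x : Rn n ↦ (x i : ℂ)) :=
  (Complex.ofRealCLM.comp
    (EuclideanSpace.proj i : Rn n →L[ℝ] ℝ)).hasTemperateGrowth

theorem hasTemperateGrowth_polyFun (P : MvPolynomial (Fin n) ℂ) :
    Function.HasTemperateGrowth (polyFun P) := by
  induction P using MvPolynomial.induction_on with
  | C a => simp +unfoldPartialApp [polyFun]
  | add p q hp hq =>
    have : polyFun (p + q) = fun x ↦ polyFun p x + polyFun q x := by ext; simp [polyFun]
    rw [this]; exact hp.add hq
  | mul_X p i hp =>
    have : polyFun (p * MvPolynomial.X i) = fun x ↦ polyFun p x * (x i : ℂ) := by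
      ext; simp [polyFun]
    rw [this]; exact hp.mul (hasTemperateGrowth_coord i)

/-- A polynomial as a tempered distribution. -/
def polyDist (P : MvPolynomial (Fin n) ℂ) : 𝓢'(Rn n, ℂ) :=
  (hasTemperateGrowth_polyFun P).toTemperedDistribution volume

theorem polyDist_apply (P : MvPolynomial (Fin n) ℂ) (ψ : 𝓢(Rn n, ℂ)) :
    polyDist P ψ = ∫ x, ψ x * polyFun P x := rfl

theorem integrable_mul_polyFun (P : MvPolynomial (Fin n) ℂ) (ψ : 𝓢(Rn n, ℂ)) :
    Integrable (fun x ↦ ψ x * polyFun P x) := by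
  have h := (SchwartzMap.smulLeftCLM ℂ (polyFun P) ψ).integrable (μ := volume)
  refine h.congr (Filter.Eventually.of_forall fun x ↦ ?_)
  simp [SchwartzMap.smulLeftCLM_apply_apply (hasTemperateGrowth_polyFun P), mul_comm]

/-- The space `𝒫` of polynomials, as a subspace of the tempered distributions. -/
def polynomials (n : ℕ) : Submodule ℂ 𝓢'(Rn n, ℂ) where
  carrier := Set.range polyDist
  zero_mem' := ⟨0, by ext ψ; simp [polyDist_apply, polyFun]⟩
  add_mem' := by
    rintro _ _ ⟨P, rfl⟩ ⟨Q, rfl⟩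
    refine ⟨P + Q, ?_⟩
    ext ψ
    change polyDist (P + Q) ψ = polyDist P ψ + polyDist Q ψ
    simp only [polyDist_apply]
    rw [← integral_add (integrable_mul_polyFun P ψ) (integrable_mul_polyFun Q ψ)]
    simp [polyFun, mul_add]
  smul_mem' := by
    rintro c _ ⟨P, rfl⟩
    refine ⟨c • P, ?_⟩
    ext ψ
    change polyDist (c • P) ψ = c • polyDist P ψ
    simp only [polyDist_apply]
    rw [← integral_smul]
    simp [polyFun, mul_left_comm, MvPolynomial.smul_eval]

/-- The quotient `𝓢'(ℝⁿ) / 𝒫(ℝⁿ)`. -/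
abbrev TemperedModPoly (n : ℕ) := 𝓢'(Rn n, ℂ) ⧸ polynomials n

open scoped LineDeriv in
/-- The Fourier transform of a polynomial is supported at the origin. -/
theorem polyDist_fourier_eq_zero (P : MvPolynomial (Fin n) ℂ) :
    ∀ η : 𝓢(Rn n, ℂ), (0 : Rn n) ∉ tsupport η → polyDist P (𝓕 η) = 0 := by
  induction P using MvPolynomial.induction_on with
  | C a =>
    intro η hη
    have h0 : η 0 = 0 := image_eq_zero_of_notMem_tsupport hη
    have h1 : ∫ x, (𝓕 η) x = η 0 := by
      have h2 : (𝓕⁻ (𝓕 η)) (0 : Rn n) = η 0 := by rw [fourierInv_fourier_eq]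
      rw [← h2, SchwartzMap.fourierInv_coe, Real.fourierInv_eq]
      simp
    simp only [polyDist_apply, polyFun, MvPolynomial.eval_C]
    rw [integral_mul_const, h1, h0, zero_mul]
  | add p q hp hq =>
    intro η hη
    have e : polyDist (p + q) (𝓕 η) = polyDist p (𝓕 η) + polyDist q (𝓕 η) := by
      simp only [polyDist_apply]
      rw [← integral_add (integrable_mul_polyFun p _) (integrable_mul_polyFun q _)]
      simp [polyFun, mul_add]
    rw [e, hp η hη, hq η hη, add_zero]
  | mul_X p i hp =>
    intro η hη
    have hd : (0 : Rn n) ∉ tsupport (∂_{EuclideanSpace.single i (1 : ℝ)} η : 𝓢(Rn n, ℂ)) :=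
      fun h ↦ hη (SchwartzMap.tsupport_lineDerivOp_subset _ η h)
    have key := hp _ hd
    rw [SchwartzMap.fourier_lineDerivOp_eq] at key
    have hc : (2 * Real.pi * Complex.I : ℂ) ≠ 0 := by simp [Real.pi_ne_zero]
    simp only [polyDist_apply] at key ⊢
    have hT : Function.HasTemperateGrowth
        (fun x : Rn n ↦ inner ℝ x (EuclideanSpace.single i (1 : ℝ))) := by fun_prop
    have e : ∀ x, ((2 * Real.pi * Complex.I : ℂ) • SchwartzMap.smulLeftCLM ℂ
        (fun x : Rn n ↦ inner ℝ x (EuclideanSpace.single i (1 : ℝ))) (𝓕 η)) x * polyFun p x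
        = (2 * Real.pi * Complex.I : ℂ) * ((𝓕 η) x * polyFun (p * MvPolynomial.X i) x) := by
      intro x
      rw [_root_.smul_apply, SchwartzMap.smulLeftCLM_apply_apply hT]
      simp [polyFun, EuclideanSpace.inner_single_right]
      ring
    simp only [e] at key
    rw [integral_const_mul] at key
    exact (mul_eq_zero.mp key).resolve_left hc

end Polynomials

/-! ### The Littlewood-Paley blocks -/

/-- A dyadic partition of unity: nonnegative radial smooth functions `ρ` and `φ`, supported in the
ball `|ξ| ≤ 4/3` and in the shell `3/4 ≤ |ξ| ≤ 8/3`, with `ρ(ξ) + ∑_{j ≥ 0} φ(2^{-j} ξ) = 1` for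
all `ξ`, and `∑_{j ∈ ℤ} φ(2^{-j} ξ) = 1` for all `ξ ≠ 0`. -/
structure DyadicPartition (n : ℕ) where
  ρ : Rn n → ℝ
  φ : Rn n → ℝ
  ρ_smooth : ContDiff ℝ ∞ ρ
  φ_smooth : ContDiff ℝ ∞ φ
  ρ_nonneg : ∀ ξ, 0 ≤ ρ ξ
  φ_nonneg : ∀ ξ, 0 ≤ φ ξ
  ρ_radial : ∀ ξ η, ‖ξ‖ = ‖η‖ → ρ ξ = ρ η
  φ_radial : ∀ ξ η, ‖ξ‖ = ‖η‖ → φ ξ = φ η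
  ρ_support : tsupport ρ ⊆ {ξ | ‖ξ‖ ≤ 4 / 3}
  φ_support : tsupport φ ⊆ {ξ | 3 / 4 ≤ ‖ξ‖ ∧ ‖ξ‖ ≤ 8 / 3}
  hasSum_nat : ∀ ξ, HasSum (fun j : ℕ ↦ φ ((2 : ℝ) ^ (-(j : ℤ)) • ξ)) (1 - ρ ξ)
  hasSum_int : ∀ ξ, ξ ≠ 0 → HasSum (fun j : ℤ ↦ φ ((2 : ℝ) ^ (-j) • ξ)) 1

section Blocks

variable {n : ℕ}

/-- The symbol of `φ(2^{-j} D)`, `D = -i∇`. Mathlib's Fourier transform has the kernel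
`exp(-2πi x·ξ)`, so that `D` corresponds to multiplication by `2πξ`. -/
def DyadicPartition.symbol (𝒟 : DyadicPartition n) (j : ℤ) (ξ : Rn n) : ℂ :=
  (𝒟.φ ((2 : ℝ) ^ (-j) • (2 * Real.pi) • ξ) : ℂ)

theorem DyadicPartition.zero_notMem_tsupport_symbol (𝒟 : DyadicPartition n) (j : ℤ) :
    (0 : Rn n) ∉ tsupport (𝒟.symbol j) := by
  have h0 : (0 : Rn n) ∉ tsupport 𝒟.φ := fun h ↦ by
    have := (𝒟.φ_support h).1
    norm_num at this
  rw [notMem_tsupport_iff_eventuallyEq] at h0 ⊢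
  have hc : Filter.Tendsto (fun ξ : Rn n ↦ (2 : ℝ) ^ (-j) • (2 * Real.pi) • ξ)
      (nhds 0) (nhds 0) := by
    have : Continuous (fun ξ : Rn n ↦ (2 : ℝ) ^ (-j) • (2 * Real.pi) • ξ) := by fun_prop
    simpa using this.tendsto 0
  filter_upwards [hc.eventually h0] with ξ hξ
  simpa [DyadicPartition.symbol] using hξ

/-- The homogeneous block `f ↦ φ(2^{-j} D) f = 𝓕⁻¹ (φ(2^{-j} ·) 𝓕 f)`. It annihilates polynomials,
and so it is defined on `𝓢'/𝒫`, with values in `𝓢'`. -/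
def DyadicPartition.block (𝒟 : DyadicPartition n) (j : ℤ) :
    TemperedModPoly n →ₗ[ℂ] 𝓢'(Rn n, ℂ) :=
  (polynomials n).liftQ
    (TemperedDistribution.fourierMultiplierCLM ℂ (𝒟.symbol j) : 𝓢'(Rn n, ℂ) →ₗ[ℂ] 𝓢'(Rn n, ℂ)) <| by
      rintro _ ⟨P, rfl⟩
      rw [LinearMap.mem_ker]
      ext ψ
      exact polyDist_fourier_eq_zero P _ fun h ↦
        𝒟.zero_notMem_tsupport_symbol j
          ((SchwartzMap.tsupport_smulLeftCLM_subset (𝒟.symbol j) (𝓕⁻ ψ) h).2)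

/-- The Besov-Lorentz quasi-norm `‖f‖_{Ḃ^s_{p,∞,∞}} = sup_j 2^{js} ‖Δ_j f‖_{L^{p,∞}}`. -/
def besovLorentzNorm (𝒟 : DyadicPartition n) (s : ℝ) (p : ℝ≥0∞) (f : TemperedModPoly n) : ℝ≥0∞ :=
  ⨆ j : ℤ, (2 : ℝ≥0∞) ^ ((j : ℝ) * s) * distWeakLorentzNorm p (𝒟.block j f)

/-- The Triebel-Lizorkin-Lorentz quasi-norm
`‖f‖_{Ḟ^s_{p,∞,∞}} = ‖sup_j 2^{js} |Δ_j f|‖_{L^{p,∞}}`. Here `G j` is the function `Δ_j f`; the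
infimum runs over its versions, which all give the same value. -/
def triebelLizorkinLorentzNorm (𝒟 : DyadicPartition n) (s : ℝ) (p : ℝ≥0∞)
    (f : TemperedModPoly n) : ℝ≥0∞ :=
  ⨅ (G : ℤ → Rn n → ℂ) (_ : ∀ j, IsRepresentedBy (𝒟.block j f) (G j)),
    weakLorentzNorm p (fun x ↦ ⨆ j : ℤ, (2 : ℝ≥0∞) ^ ((j : ℝ) * s) * ‖G j x‖ₑ)

end Blocks

/-! ### The operator `Λ^s` and the Sobolev-Lorentz quasi-norm -/

section Sobolev

variable {n : ℕ}

/-- The test functions on `ℝⁿ ∖ {0}`: smooth, with compact support that does not contain `0`. -/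
abbrev PuncturedTest (n : ℕ) :=
  {ψ : 𝓢(Rn n, ℂ) // HasCompactSupport ψ ∧ (0 : Rn n) ∉ tsupport ψ}

/-- The Fourier transform `𝓕 f` of a class `f` in `𝓢'/𝒫`, as a distribution on `ℝⁿ ∖ {0}`. It
determines the class, since the polynomials are exactly the tempered distributions whose Fourier
transform vanishes there. -/
def puncturedFourier : TemperedModPoly n →ₗ[ℂ] (PuncturedTest n → ℂ) :=
  (polynomials n).liftQ
    { toFun := fun f ψ ↦ (𝓕 f) (ψ : 𝓢(Rn n, ℂ))
      map_add' := fun f g ↦ by ext ψ; rw [FourierTransform.fourier_add]; rfl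
      map_smul' := fun c f ↦ by ext ψ; rw [FourierTransform.fourier_smul]; rfl } <| by
      rintro _ ⟨P, rfl⟩
      rw [LinearMap.mem_ker]
      ext ψ
      exact polyDist_fourier_eq_zero P _ ψ.2.2

theorem contDiff_norm_rpow_mul (s : ℝ) (ψ : PuncturedTest n) :
    ContDiff ℝ ∞ (fun ξ : Rn n ↦ (((2 * Real.pi * ‖ξ‖) ^ s : ℝ) : ℂ) * ψ.1 ξ) := by
  rw [contDiff_iff_contDiffAt]
  intro ξ
  by_cases hξ : ξ = 0
  · subst hξ
    have h := notMem_tsupport_iff_eventuallyEq.mp ψ.2.2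
    refine (contDiffAt_const (c := (0 : ℂ))).congr_of_eventuallyEq ?_
    filter_upwards [h] with x hx
    simp [hx]
  · have h1 : ContDiffAt ℝ ∞ (fun ξ : Rn n ↦ (2 * Real.pi * ‖ξ‖) ^ s) ξ := by
      refine ContDiffAt.rpow_const_of_ne (contDiffAt_const.mul (contDiffAt_norm ℝ hξ)) ?_
      have := norm_pos_iff.mpr hξ
      positivity
    exact (Complex.ofRealCLM.contDiff.contDiffAt.comp ξ h1).mul (ψ.1.smooth ⊤).contDiffAt

/-- The test function `|2πξ|^s ψ(ξ)` on `ℝⁿ ∖ {0}`. -/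
def PuncturedTest.mulNormRpow (s : ℝ) (ψ : PuncturedTest n) : PuncturedTest n :=
  ⟨(ψ.2.1.mul_left (f := fun ξ : Rn n ↦ (((2 * Real.pi * ‖ξ‖) ^ s : ℝ) : ℂ))).toSchwartzMap
      (contDiff_norm_rpow_mul s ψ),
    ψ.2.1.mul_left, fun h ↦ ψ.2.2 (tsupport_mul_subset_right h)⟩

/-- `h = Λ^s f = (-Δ)^{s/2} f` in `𝓢'/𝒫`: the Fourier transform of `h` is that of `f` times the
symbol of `Λ^s` (namely `|2πξ|^s` in Mathlib's normalization of the Fourier transform), as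
distributions on `ℝⁿ ∖ {0}`. -/
def IsFractionalLaplacian (s : ℝ) (f h : TemperedModPoly n) : Prop :=
  ∀ ψ : PuncturedTest n, puncturedFourier h ψ = puncturedFourier f (ψ.mulNormRpow s)

/-- The Sobolev-Lorentz quasi-norm `‖f‖_{Ḣ^s_{p,∞}} = ‖Λ^s f‖_{L^{p,∞}}`: the infimum of
`‖g‖_{L^{p,∞}}` over the functions `g` in the class `Λ^s f` modulo polynomials, and `∞` if there is
none. (If `p < ∞`, at most one `g` in `L^{p,∞}` is in the class; if `p = ∞`, the bounded functions
in it differ by constants.) -/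
def sobolevLorentzNorm (s : ℝ) (p : ℝ≥0∞) (f : TemperedModPoly n) : ℝ≥0∞ :=
  ⨅ (T : 𝓢'(Rn n, ℂ)) (_ : IsFractionalLaplacian s f ((polynomials n).mkQ T)),
    distWeakLorentzNorm p T

end Sobolev

end LorentzLP

end

noncomputable section

namespace LorentzLP

variable {n : ℕ}

/-! ### Calculus of the weak Lorentz quasi-norm -/

/-! The first inequality is pointwise: each weighted block is at most the supremum over `j`, and a
positive finite constant passes through the quasi-norm.

For the second, let `g` represent `Λ^s f`. The multiplier `φ(2^{-j} ξ) |ξ|^{-s}` is smooth and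
compactly supported away from the origin, and by homogeneity of `|ξ|^{-s}` it is `2^{-js}` times the
dilate by `2^j` of the one for `j = 0`. Hence `2^{js} Δ_j f` is the convolution of `g` with an
`L¹`-normalized dilate of a single Schwartz kernel. Such a convolution is at most `C M g` pointwise,
`M` being the Hardy-Littlewood maximal function, with `C` independent of the dilation
(`exists_rpow_mul_enorm_integral_le`); so the supremum over `j` costs nothing. It remains that `M`
is bounded on `L^{p,∞}` for `p > 1` (`exists_weakLorentzNorm_maximalFunction_le`), by a Vitali
covering and truncation of `g` at half the level.

The convolution formula has to be justified for distributions. Since `p > 1`, `L^{p,∞} ⊆ L¹ + L^∞`,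
and this is what makes Fubini applicable in `IsRepresentedBy.convolution`. The choice of
representative modulo polynomials is harmless, because the multipliers vanish near the origin. -/

theorem distributionFunction_mono {u v : Rn n → ℝ≥0∞} (h : ∀ x, u x ≤ v x) (α : ℝ≥0) :
    distributionFunction u α ≤ distributionFunction v α :=
  measure_mono fun _ hx ↦ lt_of_lt_of_le hx (h _)

theorem distributionFunction_anti (u : Rn n → ℝ≥0∞) {α β : ℝ≥0} (h : α ≤ β) :
    distributionFunction u β ≤ distributionFunction u α :=
  measure_mono fun _ hx ↦ lt_of_le_of_lt (ENNReal.coe_le_coe.2 h) hx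

/-- The quasi-norm of `L^{p,∞}` in terms of the distribution function. -/
theorem weakLorentzNorm_le_iff {p A : ℝ≥0∞} {u : Rn n → ℝ≥0∞} :
    weakLorentzNorm p u ≤ A ↔ ∀ α t : ℝ≥0, 0 < α → 0 < t → (t : ℝ≥0∞) < distributionFunction u α →
      (t : ℝ≥0∞) ^ (p⁻¹).toReal * α ≤ A := by
  constructor
  · intro h α t _ ht hd
    refine le_trans ?_ ((le_iSup₂ (f := fun (t : ℝ≥0) (_ : 0 < t) ↦
      (t : ℝ≥0∞) ^ (p⁻¹).toReal * decreasingRearrangement u t) t ht).trans h)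
    gcongr
    refine le_iInf fun β ↦ le_iInf fun _ ↦ le_iInf fun hβ ↦ ?_
    by_contra! hlt
    exact absurd (hd.trans_le (distributionFunction_anti u (ENNReal.coe_lt_coe.1 hlt).le))
      (not_lt.2 hβ)
  · intro h
    refine iSup₂_le fun t ht ↦ ?_
    by_contra! hlt
    have ht0 : (t : ℝ≥0∞) ^ (p⁻¹).toReal ≠ 0 := by
      simp [ENNReal.rpow_eq_zero_iff, ht.ne']
    have htt : (t : ℝ≥0∞) ^ (p⁻¹).toReal ≠ ⊤ :=
      ENNReal.rpow_ne_top_of_nonneg ENNReal.toReal_nonneg ENNReal.coe_ne_top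
    -- A level `α` strictly between `A / t^{1/p}` and `u^*(t)` is not admissible in the infimum
    -- defining `u^*(t)`, so `|{u > α}| > t`.
    rw [mul_comm, ← ENNReal.div_lt_iff (Or.inl ht0) (Or.inl htt)] at hlt
    obtain ⟨α, hα, hα'⟩ := ENNReal.lt_iff_exists_nnreal_btwn.1 hlt
    have hα0 : 0 < α := by
      have := (zero_le (a := A / (t : ℝ≥0∞) ^ (p⁻¹).toReal)).trans_lt hα
      exact_mod_cast this
    have hd : (t : ℝ≥0∞) < distributionFunction u α := by
      by_contra! hd
      exact absurd (iInf_le_of_le α (iInf_le_of_le hα0 (iInf_le _ hd))) (not_le.2 hα')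
    rw [ENNReal.div_lt_iff (Or.inl ht0) (Or.inl htt), mul_comm] at hα
    exact absurd (h α t hα0 ht hd) (not_le.2 hα)

theorem weakLorentzNorm_mono (p : ℝ≥0∞) {u v : Rn n → ℝ≥0∞} (h : ∀ x, u x ≤ v x) :
    weakLorentzNorm p u ≤ weakLorentzNorm p v :=
  weakLorentzNorm_le_iff.2 fun α t hα ht hd ↦
    weakLorentzNorm_le_iff.1 le_rfl α t hα ht (hd.trans_le (distributionFunction_mono h α))

theorem weakLorentzNorm_const_mul_le (p : ℝ≥0∞) {c : ℝ≥0} (hc : c ≠ 0) (u : Rn n → ℝ≥0∞) :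
    weakLorentzNorm p (fun x ↦ c * u x) ≤ c * weakLorentzNorm p u := by
  refine weakLorentzNorm_le_iff.2 fun α t hα ht hd ↦ ?_
  have hc' : 0 < c := pos_iff_ne_zero.2 hc
  have hcc : (c : ℝ≥0∞) * ↑(c⁻¹ * α) = α := by
    rw [← ENNReal.coe_mul, mul_inv_cancel_left₀ hc]
  have key := weakLorentzNorm_le_iff.1 (le_refl (weakLorentzNorm p u)) (c⁻¹ * α) t
    (by positivity) ht (hd.trans_le (measure_mono fun x hx ↦ ?_))
  · calc (t : ℝ≥0∞) ^ (p⁻¹).toReal * α = c * (t ^ (p⁻¹).toReal * ↑(c⁻¹ * α)) := by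
          rw [mul_left_comm, hcc]
      _ ≤ _ := by gcongr
  · simp only [Set.mem_ofPred_eq] at hx ⊢
    rw [← hcc] at hx
    exact lt_of_mul_lt_mul_left' hx

theorem const_mul_weakLorentzNorm_le (p : ℝ≥0∞) {c : ℝ≥0} (hc : c ≠ 0) (u : Rn n → ℝ≥0∞) :
    c * weakLorentzNorm p u ≤ weakLorentzNorm p (fun x ↦ c * u x) := by
  have h := weakLorentzNorm_const_mul_le p (inv_ne_zero hc) (fun x ↦ c * u x)
  have e : ∀ a : ℝ≥0∞, (↑(c⁻¹) : ℝ≥0∞) * (c * a) = a := fun a ↦ by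
    rw [← mul_assoc, ← ENNReal.coe_mul, inv_mul_cancel₀ hc, ENNReal.coe_one, one_mul]
  simp only [e] at h
  calc c * weakLorentzNorm p u ≤ c * (↑(c⁻¹) * weakLorentzNorm p fun x ↦ c * u x) := by gcongr
    _ = _ := by rw [← mul_assoc, ← ENNReal.coe_mul, mul_inv_cancel₀ hc, ENNReal.coe_one, one_mul]

/-- For finite `p`, the distribution function of `u` decays like `α^{-p}`. -/
theorem distributionFunction_le_of_weakLorentzNorm_le {p A : ℝ≥0∞} (hp0 : p ≠ 0) (hp : p ≠ ⊤)
    {u : Rn n → ℝ≥0∞} (h : weakLorentzNorm p u ≤ A) {α : ℝ≥0} (hα : 0 < α) :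
    distributionFunction u α ≤ (A / α) ^ p.toReal := by
  refine ENNReal.le_of_forall_nnreal_lt fun t ht ↦ ?_
  rcases eq_or_ne t 0 with rfl | ht0
  · simp
  have hp' : 0 < p.toReal := ENNReal.toReal_pos hp0 hp
  have key := weakLorentzNorm_le_iff.1 h α t hα (pos_iff_ne_zero.2 ht0) ht
  rw [← ENNReal.le_div_iff_mul_le (Or.inl (by simpa using hα.ne')) (Or.inl ENNReal.coe_ne_top),
    ENNReal.toReal_inv] at key
  exact (ENNReal.rpow_inv_le_iff hp').1 key

theorem weakLorentzNorm_le_of_distributionFunction_le {p A : ℝ≥0∞} (hp0 : p ≠ 0) (hp : p ≠ ⊤)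
    {u : Rn n → ℝ≥0∞} (h : ∀ α : ℝ≥0, 0 < α → distributionFunction u α ≤ (A / α) ^ p.toReal) :
    weakLorentzNorm p u ≤ A := by
  refine weakLorentzNorm_le_iff.2 fun α t hα _ hd ↦ ?_
  have hp' : 0 < p.toReal := ENNReal.toReal_pos hp0 hp
  rw [← ENNReal.le_div_iff_mul_le (Or.inl (by simpa using hα.ne')) (Or.inl ENNReal.coe_ne_top),
    ENNReal.toReal_inv]
  exact (ENNReal.rpow_inv_le_iff hp').2 (hd.le.trans (h α hα))

/-- For `p = ∞` the weight `t^{1/p}` is `1`, so the quasi-norm is the essential supremum: every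
level above it is exceeded only on a null set, and countably many levels suffice. -/
theorem weakLorentzNorm_top_le_iff {A : ℝ≥0∞} {u : Rn n → ℝ≥0∞} :
    weakLorentzNorm ⊤ u ≤ A ↔ ∀ᵐ x, u x ≤ A := by
  constructor
  · intro h
    rcases eq_or_ne A ⊤ with rfl | hA
    · simp
    lift A to ℝ≥0 using hA
    have hz : ∀ k : ℕ, ∀ᵐ x, u x ≤ ↑(A + (k + 1 : ℝ≥0)⁻¹) := by
      intro k
      by_contra hne
      have hne' : distributionFunction u (A + (k + 1 : ℝ≥0)⁻¹) ≠ 0 := fun h0 ↦ hne (by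
        rw [ae_iff]; simpa [distributionFunction] using h0)
      obtain ⟨t, ht, ht'⟩ := ENNReal.lt_iff_exists_nnreal_btwn.1 (pos_iff_ne_zero.2 hne')
      have := weakLorentzNorm_le_iff.1 h _ t (by positivity) (by exact_mod_cast ht) ht'
      simp only [ENNReal.inv_top, ENNReal.toReal_zero, ENNReal.rpow_zero, one_mul] at this
      have h3 : A + (k + 1 : ℝ≥0)⁻¹ ≤ A := by exact_mod_cast this
      have h4 : (0 : ℝ≥0) < (k + 1 : ℝ≥0)⁻¹ := by positivity
      exact absurd h3 (not_le.2 (lt_add_of_pos_right _ h4))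
    filter_upwards [ae_all_iff.2 hz] with x hx
    refine ENNReal.le_of_forall_pos_le_add fun ε hε _ ↦ ?_
    obtain ⟨k, hk⟩ := exists_nat_one_div_lt (show (0 : ℝ) < ε from hε)
    refine (hx k).trans ?_
    rw [← ENNReal.coe_add]
    refine ENNReal.coe_le_coe.2 (add_le_add le_rfl ?_)
    rw [← NNReal.coe_le_coe]
    simpa using hk.le
  · intro h
    refine weakLorentzNorm_le_iff.2 fun α t _ ht hd ↦ ?_
    simp only [ENNReal.inv_top, ENNReal.toReal_zero, ENNReal.rpow_zero, one_mul]
    by_contra! hlt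
    have : distributionFunction u α = 0 :=
      measure_mono_null (fun x hx ↦ not_le.2 (hlt.trans hx)) (ae_iff.1 h)
    simp [this] at hd

open Metric

/-! ### The Hardy-Littlewood maximal function -/

/-- The centred Hardy-Littlewood maximal function. -/
def maximalFunction (u : Rn n → ℝ≥0∞) (x : Rn n) : ℝ≥0∞ :=
  ⨆ (r : ℝ) (_ : 0 < r), (∫⁻ y in closedBall x r, u y) / volume (closedBall x r)

theorem volume_closedBall_ne_zero (x : Rn n) {r : ℝ} (hr : 0 < r) :
    volume (closedBall x r) ≠ 0 :=
  (measure_closedBall_pos _ _ hr).ne'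

theorem volume_closedBall_ne_top (x : Rn n) (r : ℝ) : volume (closedBall x r) ≠ ⊤ :=
  measure_closedBall_lt_top.ne

theorem lintegral_closedBall_le_maximalFunction (u : Rn n → ℝ≥0∞) (x : Rn n) {r : ℝ} (hr : 0 < r) :
    ∫⁻ y in closedBall x r, u y ≤ volume (closedBall x r) * maximalFunction u x := by
  rw [mul_comm, ← ENNReal.div_le_iff (volume_closedBall_ne_zero x hr) (volume_closedBall_ne_top x r)]
  exact le_iSup₂ (f := fun (r : ℝ) (_ : 0 < r) ↦
    (∫⁻ y in closedBall x r, u y) / volume (closedBall x r)) r hr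

theorem volume_closedBall_mul (x : Rn n) {c r : ℝ} (hc : 0 ≤ c) (hr : 0 ≤ r) :
    volume (closedBall x (c * r)) = ENNReal.ofReal (c ^ n) * volume (closedBall x r) := by
  rw [Measure.addHaar_closedBall _ _ (mul_nonneg hc hr), Measure.addHaar_closedBall _ _ hr,
    mul_pow, ENNReal.ofReal_mul (by positivity), mul_assoc]
  simp

/-- The weak type `(1,1)` inequality. -/
theorem distributionFunction_maximalFunction_le (hn : 0 < n) (u : Rn n → ℝ≥0∞)
    (hu : ∫⁻ y, u y ≠ ⊤) {α : ℝ≥0} (hα : 0 < α) :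
    distributionFunction (maximalFunction u) α ≤ ENNReal.ofReal (5 ^ n) * ((∫⁻ y, u y) / α) := by
  have hα0 : (α : ℝ≥0∞) ≠ 0 := by simpa using hα.ne'
  have hex : ∀ x : Rn n, ∃ r : ℝ, 0 < r ∧ ((α : ℝ≥0∞) < maximalFunction u x →
      volume (closedBall x r) ≤ (∫⁻ y in closedBall x r, u y) / α) := by
    intro x
    by_cases hx : (α : ℝ≥0∞) < maximalFunction u x
    · obtain ⟨r, hr⟩ := lt_iSup_iff.1 hx
      obtain ⟨hr0, hr⟩ := lt_iSup_iff.1 hr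
      refine ⟨r, hr0, fun _ ↦ ?_⟩
      rw [ENNReal.lt_div_iff_mul_lt (Or.inl (volume_closedBall_ne_zero x hr0))
        (Or.inl (volume_closedBall_ne_top x r)), mul_comm] at hr
      exact (ENNReal.le_div_iff_mul_le (Or.inl hα0) (Or.inl ENNReal.coe_ne_top)).2 hr.le
    · exact ⟨1, one_pos, fun h ↦ absurd h hx⟩
  choose r hr0 hr using hex
  set S : Set (Rn n) := {x | (α : ℝ≥0∞) < maximalFunction u x} with hS
  -- The Vitali lemma needs bounded radii. Here `r^n |B_1| ≤ (∫ u) / α` gives `r^n ≤ K`, and `r ≤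
  -- r^n` for `r > 1` because `n > 0`.
  set K : ℝ≥0∞ := (∫⁻ y, u y) / α / volume (ball (0 : Rn n) 1) with hK
  have hKtop : K ≠ ⊤ := ENNReal.div_ne_top (ENNReal.div_ne_top hu hα0)
    (measure_ball_pos _ _ one_pos).ne'
  have hbound : ∀ x ∈ S, r x ≤ max 1 K.toReal := by
    intro x hx
    by_contra! hlt
    obtain ⟨h1, h2⟩ := max_lt_iff.1 hlt
    have h3 : ENNReal.ofReal (r x ^ n) ≤ K := by
      rw [hK, ENNReal.le_div_iff_mul_le (Or.inl (measure_ball_pos _ _ one_pos).ne')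
        (Or.inl measure_ball_lt_top.ne)]
      have := hr x hx
      rw [Measure.addHaar_closedBall _ _ (hr0 x).le] at this
      simp only [finrank_euclideanSpace, Fintype.card_fin] at this
      exact this.trans (ENNReal.div_le_div_right (setLIntegral_le_lintegral _ _) _)
    have h4 : r x ^ n ≤ K.toReal := (ENNReal.ofReal_le_iff_le_toReal hKtop).1 h3
    have h5 : r x ≤ r x ^ n := le_self_pow₀ h1.le hn.ne'
    linarith
  obtain ⟨w, hwS, hdisj, hcov⟩ := Vitali.exists_disjoint_subfamily_covering_enlargement_closedBall
    S id r _ hbound 5 (by norm_num)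
  have hcount : w.Countable := hdisj.countable_of_nonempty_interior fun x _ ↦
    ⟨x, interior_mono ball_subset_closedBall (by
      rw [isOpen_ball.interior_eq]; exact mem_ball_self (hr0 x))⟩
  have : Countable w := hcount.to_subtype
  -- Only monotonicity and countable subadditivity are applied to the level set, so the maximal
  -- function need not be known to be measurable.
  calc distributionFunction (maximalFunction u) α
      ≤ volume (⋃ b : w, closedBall (b : Rn n) (5 * r b)) := by
        refine measure_mono fun x hx ↦ ?_
        obtain ⟨b, hb, hsub⟩ := hcov x hx
        exact Set.mem_iUnion.2 ⟨⟨b, hb⟩, hsub (mem_closedBall_self (hr0 x).le)⟩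
    _ ≤ ∑' b : w, volume (closedBall (b : Rn n) (5 * r b)) := measure_iUnion_le _
    _ ≤ ∑' b : w, ENNReal.ofReal (5 ^ n) * ((∫⁻ y in closedBall (b : Rn n) (r b), u y) / α) := by
        refine ENNReal.tsum_le_tsum fun b ↦ ?_
        rw [volume_closedBall_mul _ (by norm_num) (hr0 b).le]
        gcongr
        exact hr b (hwS b.2)
    _ = ENNReal.ofReal (5 ^ n) * ((∫⁻ y in ⋃ b : w, closedBall (b : Rn n) (r b), u y) / α) := by
        have hd : Pairwise (Function.onFun Disjoint
            fun b : w ↦ closedBall (b : Rn n) (r b)) := fun a b hab ↦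
          hdisj a.2 b.2 fun h ↦ hab (Subtype.ext h)
        rw [ENNReal.tsum_mul_left, lintegral_iUnion (fun _ ↦ measurableSet_closedBall) hd]
        simp only [div_eq_mul_inv, ENNReal.tsum_mul_right]
    _ ≤ _ := by
        gcongr
        exact Measure.restrict_le_self

/-- If `u` lies in `L^{p,∞}` with `1 < p < ∞`, its large part is integrable. -/
theorem lintegral_indicator_le_of_weakLorentzNorm_le {p A : ℝ≥0∞} (hp : 1 < p) (hpt : p ≠ ⊤)
    {u : Rn n → ℝ≥0∞} (hu : AEMeasurable u) (hut : ∀ x, u x ≠ ⊤) (h : weakLorentzNorm p u ≤ A)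
    {α : ℝ≥0} (hα : 0 < α) :
    ∫⁻ x, {x | (α : ℝ≥0∞) < u x}.indicator u x ≤
      2 * α * (A / α) ^ p.toReal * (1 - 2 * (2⁻¹ : ℝ≥0∞) ^ p.toReal)⁻¹ := by
  have hp0 : p ≠ 0 := (zero_lt_one.trans hp).ne'
  have hpos : 0 < p.toReal := ENNReal.toReal_pos hp0 hpt
  -- Dyadic layers: where `2^k α < u ≤ 2^(k+1) α`, the `k`-th term alone dominates `u`. This `k` is
  -- one less than the first exponent with `u ≤ 2^k α`, which is nonzero since `u > α`.
  have hpt2 : ∀ x, {x | (α : ℝ≥0∞) < u x}.indicator u x ≤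
      ∑' k : ℕ, {x | ((2 ^ k * α : ℝ≥0) : ℝ≥0∞) < u x}.indicator
        (fun _ ↦ ((2 ^ (k + 1) * α : ℝ≥0) : ℝ≥0∞)) x := by
    intro x
    by_cases hx : (α : ℝ≥0∞) < u x
    swap
    · simp [Set.indicator_of_notMem (show x ∉ {x | (α : ℝ≥0∞) < u x} from hx)]
    have hex : ∃ k : ℕ, u x ≤ ((2 ^ k * α : ℝ≥0) : ℝ≥0∞) := by
      lift u x to ℝ≥0 using hut x with a
      obtain ⟨k, hk⟩ := pow_unbounded_of_one_lt (a / α) (show (1 : ℝ≥0) < 2 by norm_num)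
      exact ⟨k, by exact_mod_cast ((div_lt_iff₀ hα).1 hk).le⟩
    classical
    obtain ⟨k, hk⟩ : ∃ k, Nat.find hex = k + 1 := by
      refine Nat.exists_eq_succ_of_ne_zero fun h0 ↦ ?_
      have := Nat.find_spec hex
      rw [h0] at this
      exact absurd (by simpa using this) (not_le.2 hx)
    have h1 := Nat.find_spec hex
    have h2 := Nat.find_min hex (m := k) (by omega)
    rw [hk] at h1
    refine le_trans ?_ (ENNReal.le_tsum k)
    rw [Set.indicator_of_mem (show x ∈ {x | (α : ℝ≥0∞) < u x} from hx),
      Set.indicator_of_mem (show x ∈ {x | ((2 ^ k * α : ℝ≥0) : ℝ≥0∞) < u x} from not_le.1 h2)]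
    exact h1
  have hα0 : (α : ℝ≥0∞) ≠ 0 := by simpa using hα.ne'
  calc _ ≤ ∫⁻ x, ∑' k : ℕ, {x | ((2 ^ k * α : ℝ≥0) : ℝ≥0∞) < u x}.indicator
        (fun _ ↦ ((2 ^ (k + 1) * α : ℝ≥0) : ℝ≥0∞)) x := lintegral_mono hpt2
    _ = ∑' k : ℕ, ∫⁻ x, {x | ((2 ^ k * α : ℝ≥0) : ℝ≥0∞) < u x}.indicator
        (fun _ ↦ ((2 ^ (k + 1) * α : ℝ≥0) : ℝ≥0∞)) x :=
        lintegral_tsum fun k ↦ aemeasurable_const.indicator₀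
          (nullMeasurableSet_lt aemeasurable_const hu)
    _ ≤ ∑' k : ℕ, ((2 ^ (k + 1) * α : ℝ≥0) : ℝ≥0∞) * (A / (2 ^ k * α : ℝ≥0)) ^ p.toReal := by
        refine ENNReal.tsum_le_tsum fun k ↦ (lintegral_indicator_const_le _ _).trans ?_
        gcongr
        exact distributionFunction_le_of_weakLorentzNorm_le hp0 hpt h (by positivity)
    _ = ∑' k : ℕ, 2 * α * (A / α) ^ p.toReal * (2 * (2⁻¹ : ℝ≥0∞) ^ p.toReal) ^ k := by
        refine tsum_congr fun k ↦ ?_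
        have e : A / ((2 ^ k * α : ℝ≥0) : ℝ≥0∞) = (A / α) * (2⁻¹ : ℝ≥0∞) ^ k := by
          push_cast
          rw [div_eq_mul_inv, div_eq_mul_inv, ENNReal.mul_inv (by simp) (by simp),
            ENNReal.inv_pow]
          ring
        rw [e, ENNReal.mul_rpow_of_nonneg _ _ hpos.le, ← ENNReal.rpow_natCast, ← ENNReal.rpow_mul,
          mul_comm (k : ℝ), ENNReal.rpow_mul, ENNReal.rpow_natCast]
        push_cast
        ring
    _ = _ := by rw [ENNReal.tsum_mul_left, ENNReal.tsum_geometric]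

/-- The ratio of the geometric series over dyadic layers: heights double while measures shrink by
`2^{-q}`. This is where `p > 1` is needed. -/
theorem two_mul_inv_two_rpow_lt_one {q : ℝ} (hq : 1 < q) : 2 * (2⁻¹ : ℝ≥0∞) ^ q < 1 := by
  have : (2⁻¹ : ℝ≥0∞) ^ q < (2⁻¹ : ℝ≥0∞) ^ (1 : ℝ) :=
    ENNReal.rpow_lt_rpow_of_exponent_gt (by simp) (by norm_num) hq
  rw [ENNReal.rpow_one] at this
  calc 2 * (2⁻¹ : ℝ≥0∞) ^ q < 2 * 2⁻¹ := by
        exact ENNReal.mul_lt_mul_right (by simp) (by simp) this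
    _ = 1 := ENNReal.mul_inv_cancel (by simp) (by simp)

theorem inv_one_sub_two_mul_rpow_ne_top {p : ℝ≥0∞} (hp : 1 < p) (hpt : p ≠ ⊤) :
    (1 - 2 * (2⁻¹ : ℝ≥0∞) ^ p.toReal)⁻¹ ≠ ⊤ := by
  refine ENNReal.inv_ne_top.2 (tsub_pos_of_lt (two_mul_inv_two_rpow_lt_one ?_)).ne'
  simpa using (ENNReal.toReal_lt_toReal ENNReal.one_ne_top hpt).2 hp

/-- `L^{p,∞} ⊆ L¹ + L^∞` for `p > 1`. -/
theorem exists_lintegral_indicator_ne_top {p : ℝ≥0∞} (hp : 1 < p) {u : Rn n → ℝ≥0∞}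
    (hu : AEMeasurable u) (hut : ∀ x, u x ≠ ⊤) (h : weakLorentzNorm p u ≠ ⊤) :
    ∃ α : ℝ≥0, ∫⁻ x, {x | (α : ℝ≥0∞) < u x}.indicator u x ≠ ⊤ := by
  rcases eq_or_ne p ⊤ with rfl | hpt
  · lift weakLorentzNorm ⊤ u to ℝ≥0 using h with a ha
    refine ⟨a, ?_⟩
    have h0 : ∀ᵐ x, {x | (a : ℝ≥0∞) < u x}.indicator u x = 0 := by
      filter_upwards [weakLorentzNorm_top_le_iff.1 ha.ge] with x hx
      exact Set.indicator_of_notMem (s := {x | (a : ℝ≥0∞) < u x}) (not_lt.2 hx) u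
    rw [lintegral_congr_ae h0]
    simp
  · refine ⟨1, ne_top_of_le_ne_top ?_
      (lintegral_indicator_le_of_weakLorentzNorm_le hp hpt hu hut le_rfl (α := 1) one_pos)⟩
    refine ENNReal.mul_ne_top (ENNReal.mul_ne_top (by simp) ?_)
      (inv_one_sub_two_mul_rpow_ne_top hp hpt)
    exact ENNReal.rpow_ne_top_of_nonneg ENNReal.toReal_nonneg (by simpa using h)

theorem maximalFunction_le_of_ae_le {u : Rn n → ℝ≥0∞} {A : ℝ≥0∞} (h : ∀ᵐ x, u x ≤ A) (x : Rn n) :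
    maximalFunction u x ≤ A := by
  refine iSup₂_le fun r hr ↦ ?_
  rw [ENNReal.div_le_iff (volume_closedBall_ne_zero x hr) (volume_closedBall_ne_top x r)]
  calc _ ≤ ∫⁻ _ in closedBall x r, A := lintegral_mono_ae (ae_restrict_of_ae h)
    _ = _ := by simp

/-- Truncation at height `α`: what remains of `u` is at most `α`, and so are its averages. -/
theorem maximalFunction_le_add {u : Rn n → ℝ≥0∞} {α : ℝ≥0∞} (x : Rn n) :
    maximalFunction u x ≤ maximalFunction ({x | α < u x}.indicator u) x + α := by
  refine iSup₂_le fun r hr ↦ ?_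
  rw [ENNReal.div_le_iff (volume_closedBall_ne_zero x hr) (volume_closedBall_ne_top x r), add_mul]
  calc ∫⁻ y in closedBall x r, u y
      ≤ ∫⁻ y in closedBall x r, ({x | α < u x}.indicator u y + α) := by
        refine lintegral_mono fun y ↦ ?_
        by_cases hy : α < u y
        · simp [Set.indicator_of_mem (show y ∈ {x | α < u x} from hy)]
        · exact (not_lt.1 hy).trans le_add_self
    _ = (∫⁻ y in closedBall x r, {x | α < u x}.indicator u y) + α * volume (closedBall x r) := by
        rw [lintegral_add_right _ measurable_const]; simp
    _ ≤ _ := by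
        rw [mul_comm (maximalFunction _ _)]
        gcongr
        exact lintegral_closedBall_le_maximalFunction _ _ hr

/-- The maximal function is bounded on `L^{p,∞}`, `1 < p ≤ ∞`. -/
theorem exists_weakLorentzNorm_maximalFunction_le (hn : 0 < n) {p : ℝ≥0∞} (hp : 1 < p) :
    ∃ C : ℝ≥0, ∀ u : Rn n → ℝ≥0∞, AEMeasurable u → (∀ x, u x ≠ ⊤) → weakLorentzNorm p u ≠ ⊤ →
      weakLorentzNorm p (maximalFunction u) ≤ C * weakLorentzNorm p u := by
  rcases eq_or_ne p ⊤ with rfl | hpt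
  · refine ⟨1, fun u _ _ _ ↦ weakLorentzNorm_top_le_iff.2 (Filter.Eventually.of_forall fun x ↦ ?_)⟩
    rw [ENNReal.coe_one, one_mul]
    exact maximalFunction_le_of_ae_le (weakLorentzNorm_top_le_iff.1 le_rfl) x
  have hp0 : p ≠ 0 := (zero_lt_one.trans hp).ne'
  have hpos : 0 < p.toReal := ENNReal.toReal_pos hp0 hpt
  set c := (1 - 2 * (2⁻¹ : ℝ≥0∞) ^ p.toReal)⁻¹ with hc
  set D : ℝ≥0∞ := ENNReal.ofReal (5 ^ n) * (2 * c) with hD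
  have hDt : D ≠ ⊤ := ENNReal.mul_ne_top ENNReal.ofReal_ne_top
    (ENNReal.mul_ne_top (by simp) (inv_one_sub_two_mul_rpow_ne_top hp hpt))
  have hCt : D ^ (p.toReal)⁻¹ * 2 ≠ ⊤ :=
    ENNReal.mul_ne_top (ENNReal.rpow_ne_top_of_nonneg (by positivity) hDt) (by simp)
  refine ⟨(D ^ (p.toReal)⁻¹ * 2).toNNReal, fun u hu hut hA ↦ ?_⟩
  rw [ENNReal.coe_toNNReal hCt]
  set A := weakLorentzNorm p u with hAdef
  refine weakLorentzNorm_le_of_distributionFunction_le hp0 hpt fun α hα ↦ ?_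
  -- Half of the level `α` is spent on the part of `u` below `β`; the part above `β` is integrable
  -- and must account for the other half through the weak type `(1,1)` inequality.
  set β : ℝ≥0 := α / 2 with hβ
  have hβ0 : 0 < β := by positivity
  have hβ0' : (β : ℝ≥0∞) ≠ 0 := by simpa using hβ0.ne'
  have hα2 : (α : ℝ≥0∞) = 2 * β := by
    rw [hβ]; norm_cast; rw [mul_div_cancel₀]; norm_num
  have hI := lintegral_indicator_le_of_weakLorentzNorm_le hp hpt hu hut (le_refl A) hβ0
  have hIt : ∫⁻ x, {x | (β : ℝ≥0∞) < u x}.indicator u x ≠ ⊤ := by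
    refine ne_top_of_le_ne_top ?_ hI
    refine ENNReal.mul_ne_top (ENNReal.mul_ne_top (ENNReal.mul_ne_top (by simp) (by simp)) ?_)
      (inv_one_sub_two_mul_rpow_ne_top hp hpt)
    exact ENNReal.rpow_ne_top_of_nonneg hpos.le (ENNReal.div_ne_top hA hβ0')
  calc distributionFunction (maximalFunction u) α
      ≤ distributionFunction (maximalFunction ({x | (β : ℝ≥0∞) < u x}.indicator u)) β := by
        refine measure_mono fun x hx ↦ ?_
        have h1 : (α : ℝ≥0∞) < _ := lt_of_lt_of_le hx (maximalFunction_le_add (α := β) x)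
        rw [hα2, two_mul] at h1
        exact lt_of_add_lt_add_right h1
    _ ≤ ENNReal.ofReal (5 ^ n) * ((∫⁻ x, {x | (β : ℝ≥0∞) < u x}.indicator u x) / β) :=
        distributionFunction_maximalFunction_le hn _ hIt hβ0
    _ ≤ ENNReal.ofReal (5 ^ n) * ((2 * β * (A / β) ^ p.toReal * c) / β) := by gcongr
    _ = D * (A / β) ^ p.toReal := by
        rw [hD, div_eq_mul_inv]
        calc _ = ENNReal.ofReal (5 ^ n) * (2 * c) * (A / β) ^ p.toReal * (β * (β : ℝ≥0∞)⁻¹) := by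
              ring
          _ = _ := by rw [ENNReal.mul_inv_cancel hβ0' ENNReal.coe_ne_top, mul_one]
    _ = (D ^ (p.toReal)⁻¹ * 2 * A / α) ^ p.toReal := by
        have e : D ^ (p.toReal)⁻¹ * 2 * A / α = D ^ (p.toReal)⁻¹ * (A / β) := by
          rw [hα2, div_eq_mul_inv, div_eq_mul_inv, ENNReal.mul_inv (by simp) (by simp)]
          calc _ = D ^ (p.toReal)⁻¹ * (A * (β : ℝ≥0∞)⁻¹) * (2 * 2⁻¹) := by ring
            _ = _ := by rw [ENNReal.mul_inv_cancel (by simp) (by simp), mul_one]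
        rw [e, ENNReal.mul_rpow_of_nonneg _ _ hpos.le, ENNReal.rpow_inv_rpow hpos.ne']

/-! ### Convolution with dilated Schwartz functions -/

/-- Decay of order `n + 1`, one more than the dimension, leaves a summable factor `2^{-i}` after
multiplication by the volume of a ball of radius `2^i`. -/
theorem exists_norm_schwartz_le (K : 𝓢(Rn n, ℂ)) :
    ∃ B : ℝ, 0 ≤ B ∧ ∀ (z : Rn n) (i : ℕ), (2 : ℝ) ^ i ≤ 2 * (1 + ‖z‖) →
      ‖K z‖ ≤ B / (2 ^ i) ^ (n + 1) := by
  set A : ℝ := 2 ^ (n + 1) *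
    (Finset.Iic (n + 1, 0)).sup (fun m ↦ SchwartzMap.seminorm ℂ m.1 m.2) K with hA
  have hdec : ∀ z, (1 + ‖z‖) ^ (n + 1) * ‖K z‖ ≤ A := fun z ↦ by
    simpa using SchwartzMap.one_add_le_sup_seminorm_apply (𝕜 := ℂ) (m := (n + 1, 0))
      (k := n + 1) (n := 0) le_rfl le_rfl K z
  have hA0 : 0 ≤ A := (by positivity : 0 ≤ (1 + ‖(0 : Rn n)‖) ^ (n + 1) * ‖K 0‖).trans (hdec 0)
  refine ⟨2 ^ (n + 1) * A, by positivity, fun z i hi ↦ ?_⟩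
  rw [le_div_iff₀ (by positivity)]
  calc ‖K z‖ * (2 ^ i) ^ (n + 1) ≤ ‖K z‖ * (2 * (1 + ‖z‖)) ^ (n + 1) := by gcongr
    _ = 2 ^ (n + 1) * ((1 + ‖z‖) ^ (n + 1) * ‖K z‖) := by rw [mul_pow]; ring
    _ ≤ _ := by gcongr; exact hdec z

/-- Majorizing the kernel by a sum of indicators of balls turns convolution into a sum of averages.
The term used at `z` is the first `i` with `‖z‖ ≤ 2^i`; minimality gives `2^i ≤ 2 (1 + ‖z‖)`. -/
theorem exists_enorm_schwartz_le_tsum (K : 𝓢(Rn n, ℂ)) :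
    ∃ B : ℝ, 0 ≤ B ∧ ∀ z : Rn n, ‖K z‖ₑ ≤ ∑' i : ℕ, (closedBall (0 : Rn n) (2 ^ i)).indicator
      (fun _ ↦ ENNReal.ofReal (B / (2 ^ i) ^ (n + 1))) z := by
  obtain ⟨B, hB, hK⟩ := exists_norm_schwartz_le K
  refine ⟨B, hB, fun z ↦ ?_⟩
  have hex : ∃ i : ℕ, ‖z‖ ≤ (2 : ℝ) ^ i :=
    (pow_unbounded_of_one_lt ‖z‖ one_lt_two).imp fun _ h ↦ h.le
  classical
  refine le_trans ?_ (ENNReal.le_tsum (Nat.find hex))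
  rw [Set.indicator_of_mem (by simpa using Nat.find_spec hex), ← ofReal_norm]
  refine ENNReal.ofReal_le_ofReal (hK z _ ?_)
  rcases h : Nat.find hex with _ | i
  · rw [pow_zero]; linarith [norm_nonneg z]
  · have := Nat.find_min hex (m := i) (by omega)
    rw [pow_succ]
    linarith

/-- Convolution with the `L¹`-normalized dilates of a Schwartz function is dominated by the
maximal function, uniformly in the dilation. -/
theorem exists_lintegral_dilation_le_maximalFunction (K : 𝓢(Rn n, ℂ)) :
    ∃ C : ℝ≥0, ∀ u : Rn n → ℝ≥0∞, AEMeasurable u → ∀ t : ℝ, 0 < t → ∀ x : Rn n,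
      ENNReal.ofReal (t ^ n) * ∫⁻ y, ‖K (t • (y - x))‖ₑ * u y ≤ C * maximalFunction u x := by
  obtain ⟨B, hB, hK⟩ := exists_enorm_schwartz_le_tsum K
  set V : ℝ≥0∞ := volume (ball (0 : Rn n) 1) with hV
  have hVt : V ≠ ⊤ := measure_ball_lt_top.ne
  have hCt : ENNReal.ofReal B * V * (1 - 2⁻¹)⁻¹ ≠ ⊤ :=
    ENNReal.mul_ne_top (ENNReal.mul_ne_top ENNReal.ofReal_ne_top hVt) (by simp)
  refine ⟨(ENNReal.ofReal B * V * (1 - 2⁻¹)⁻¹).toNNReal, fun u hu t ht x ↦ ?_⟩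
  rw [ENNReal.coe_toNNReal hCt]
  have hball : ∀ (i : ℕ) (y : Rn n), t • (y - x) ∈ closedBall (0 : Rn n) (2 ^ i) ↔
      y ∈ closedBall x (2 ^ i / t) := by
    intro i y
    rw [mem_closedBall_zero_iff, norm_smul, Real.norm_of_nonneg ht.le, mem_closedBall,
      dist_eq_norm, le_div_iff₀ ht, mul_comm]
  calc ENNReal.ofReal (t ^ n) * ∫⁻ y, ‖K (t • (y - x))‖ₑ * u y
      ≤ ENNReal.ofReal (t ^ n) * ∫⁻ y, ∑' i : ℕ, ENNReal.ofReal (B / (2 ^ i) ^ (n + 1)) *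
          (closedBall x (2 ^ i / t)).indicator u y := by
        gcongr with y
        refine (mul_le_mul_left (hK _) (u y)).trans_eq ?_
        rw [← ENNReal.tsum_mul_right]
        refine tsum_congr fun i ↦ ?_
        by_cases hy : y ∈ closedBall x (2 ^ i / t)
        · rw [Set.indicator_of_mem ((hball i y).2 hy), Set.indicator_of_mem hy]
        · rw [Set.indicator_of_notMem (fun h ↦ hy ((hball i y).1 h)), Set.indicator_of_notMem hy,
            zero_mul, mul_zero]
    _ = ENNReal.ofReal (t ^ n) * ∑' i : ℕ, ENNReal.ofReal (B / (2 ^ i) ^ (n + 1)) *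
          ∫⁻ y in closedBall x (2 ^ i / t), u y := by
        rw [lintegral_tsum fun i ↦ (hu.indicator measurableSet_closedBall).const_mul _]
        simp_rw [lintegral_const_mul'' _ (hu.indicator measurableSet_closedBall),
          lintegral_indicator measurableSet_closedBall]
    _ ≤ ENNReal.ofReal (t ^ n) * ∑' i : ℕ, ENNReal.ofReal (B / (2 ^ i) ^ (n + 1)) *
          (volume (closedBall x (2 ^ i / t)) * maximalFunction u x) := by
        gcongr with i
        exact lintegral_closedBall_le_maximalFunction u x (by positivity)
    _ = ∑' i : ℕ, ENNReal.ofReal B * V * maximalFunction u x * (2⁻¹ : ℝ≥0∞) ^ i := by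
        rw [← ENNReal.tsum_mul_left]
        refine tsum_congr fun i ↦ ?_
        have e2 : (2⁻¹ : ℝ≥0∞) ^ i = ENNReal.ofReal ((2⁻¹ : ℝ) ^ i) := by
          rw [ENNReal.ofReal_pow (by positivity), ENNReal.ofReal_inv_of_pos two_pos]; simp
        rw [Measure.addHaar_closedBall _ _ (by positivity), e2]
        simp only [finrank_euclideanSpace, Fintype.card_fin]
        -- The dilation parameter cancels here, which makes the constant uniform in `t`.
        have e3 : t ^ n * (B / (2 ^ i) ^ (n + 1)) * (2 ^ i / t) ^ n = B * (2⁻¹ : ℝ) ^ i := by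
          rw [inv_pow, div_pow, pow_succ]; field_simp
        calc _ = ENNReal.ofReal (t ^ n) * ENNReal.ofReal (B / (2 ^ i) ^ (n + 1)) *
              ENNReal.ofReal ((2 ^ i / t) ^ n) * (V * maximalFunction u x) := by ring
          _ = _ := by
            rw [← ENNReal.ofReal_mul (by positivity), ← ENNReal.ofReal_mul (by positivity), e3,
              ENNReal.ofReal_mul hB]
            ring
    _ = _ := by rw [ENNReal.tsum_mul_left, ENNReal.tsum_geometric]; ring

/-! ### Convolution of a function in `L¹ + L^∞` with a Schwartz function -/

/-- Testing against a bump equal to `1` on a ball gives measurability there, and the balls exhaust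
the space. -/
theorem IsRepresentedBy.aestronglyMeasurable {T : 𝓢'(Rn n, ℂ)} {g : Rn n → ℂ}
    (h : IsRepresentedBy T g) : AEStronglyMeasurable g volume := by
  have hU : (⋃ N : ℕ, closedBall (0 : Rn n) N) = Set.univ := iUnion_closedBall_nat 0
  rw [← Measure.restrict_univ (μ := (volume : Measure (Rn n))), ← hU,
    aestronglyMeasurable_iUnion_iff]
  intro N
  let b : ContDiffBump (0 : Rn n) := ⟨N + 1, N + 2, by positivity, by linarith⟩
  have hsupp : HasCompactSupport (fun x ↦ (b x : ℂ)) :=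
    b.hasCompactSupport.comp_left (g := fun r : ℝ ↦ (r : ℂ)) (by simp)
  have hsm : ContDiff ℝ ∞ (fun x ↦ (b x : ℂ)) := Complex.ofRealCLM.contDiff.comp b.contDiff
  refine (h (hsupp.toSchwartzMap hsm)).1.aestronglyMeasurable.restrict.congr ?_
  filter_upwards [ae_restrict_mem measurableSet_closedBall] with x hx
  have h1 : b x = 1 := b.one_of_mem_closedBall (by
    simp only [mem_closedBall_zero_iff] at hx ⊢
    change ‖x‖ ≤ N + 1
    linarith)
  simp [h1]

/-- If `S` acts on test functions through convolution with `K` and `T` is represented by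
`g ∈ L¹ + L^∞`, then `S` is represented by the convolution of `g` with the reflection of `K`. -/
theorem IsRepresentedBy.convolution {T S : 𝓢'(Rn n, ℂ)} {g : Rn n → ℂ}
    (h : IsRepresentedBy T g) {α : ℝ≥0}
    (hα : ∫⁻ x, {x | (α : ℝ≥0∞) < ‖g x‖ₑ}.indicator (fun x ↦ ‖g x‖ₑ) x ≠ ⊤) (K : 𝓢(Rn n, ℂ))
    (hS : ∀ ψ : 𝓢(Rn n, ℂ), ∃ w : 𝓢(Rn n, ℂ), S ψ = T w ∧ ∀ y, w y = ∫ x, ψ x * K (y - x)) :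
    IsRepresentedBy S (fun x ↦ ∫ y, K (y - x) * g y) := by
  have hg := h.aestronglyMeasurable
  intro ψ
  set I := ∫⁻ x, {x | (α : ℝ≥0∞) < ‖g x‖ₑ}.indicator (fun x ↦ ‖g x‖ₑ) x with hI
  have hKb : ∀ z, ‖K z‖ₑ ≤ ENNReal.ofReal (SchwartzMap.seminorm ℂ 0 0 K) := fun z ↦ by
    rw [← ofReal_norm]
    exact ENNReal.ofReal_le_ofReal (SchwartzMap.norm_le_seminorm ℂ K z)
  set B : ℝ≥0∞ := ENNReal.ofReal (SchwartzMap.seminorm ℂ 0 0 K) with hB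
  -- The large part of `g` is paired with the supremum of `K`, the bounded part with its `L¹` norm;
  -- the bound is uniform in `x`.
  have hinner : ∀ x, ∫⁻ y, ‖K (y - x)‖ₑ * ‖g y‖ₑ ≤ B * I + (∫⁻ z, ‖K z‖ₑ) * α := by
    intro x
    have hm : Measurable fun y ↦ ‖K (y - x)‖ₑ * (α : ℝ≥0∞) := by
      have : Continuous fun y ↦ K (y - x) := K.continuous.comp (continuous_id.sub continuous_const)
      exact this.enorm.measurable.mul_const _
    calc ∫⁻ y, ‖K (y - x)‖ₑ * ‖g y‖ₑ
        ≤ ∫⁻ y, (B * {x | (α : ℝ≥0∞) < ‖g x‖ₑ}.indicator (fun x ↦ ‖g x‖ₑ) y +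
            ‖K (y - x)‖ₑ * α) := by
          refine lintegral_mono fun y ↦ ?_
          by_cases hy : (α : ℝ≥0∞) < ‖g y‖ₑ
          · rw [Set.indicator_of_mem (show y ∈ {x | (α : ℝ≥0∞) < ‖g x‖ₑ} from hy)]
            exact (mul_le_mul_left (hKb _) _).trans le_self_add
          · exact (mul_le_mul_right (not_lt.1 hy) _).trans le_add_self
      _ = B * I + (∫⁻ z, ‖K z‖ₑ) * α := by
          rw [lintegral_add_right _ hm, lintegral_const_mul' _ _ ENNReal.ofReal_ne_top,
            lintegral_mul_const' _ _ ENNReal.coe_ne_top,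
            lintegral_sub_right_eq_self (fun z ↦ ‖K z‖ₑ) x]
  have hF : Integrable (fun q : Rn n × Rn n ↦ ψ q.1 * (K (q.2 - q.1) * g q.2))
      (volume.prod volume) := by
    have hmeas : AEStronglyMeasurable (fun q : Rn n × Rn n ↦ ψ q.1 * (K (q.2 - q.1) * g q.2))
        (volume.prod volume) :=
      (ψ.continuous.comp continuous_fst).aestronglyMeasurable.mul
        ((K.continuous.comp (continuous_snd.sub continuous_fst)).aestronglyMeasurable.mul
          hg.comp_snd)
    refine ⟨hmeas, ?_⟩
    rw [hasFiniteIntegral_iff_enorm, lintegral_prod _ hmeas.enorm]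
    calc ∫⁻ x, ∫⁻ y, ‖ψ x * (K (y - x) * g y)‖ₑ
        = ∫⁻ x, ‖ψ x‖ₑ * ∫⁻ y, ‖K (y - x)‖ₑ * ‖g y‖ₑ := by
          refine lintegral_congr fun x ↦ ?_
          simp_rw [enorm_mul]
          rw [lintegral_const_mul' _ _ enorm_ne_top]
      _ ≤ ∫⁻ x, ‖ψ x‖ₑ * (B * I + (∫⁻ z, ‖K z‖ₑ) * α) := by
          gcongr with x
          exact hinner x
      _ < ⊤ := by
          rw [lintegral_mul_const _ ψ.continuous.enorm.measurable]
          have h1 : ∀ φ : 𝓢(Rn n, ℂ), ∫⁻ x, ‖φ x‖ₑ < ⊤ := fun φ ↦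
            (hasFiniteIntegral_iff_enorm).1 φ.integrable.2
          exact ENNReal.mul_lt_top (h1 ψ) (ENNReal.add_lt_top.2
            ⟨ENNReal.mul_lt_top ENNReal.ofReal_lt_top hα.lt_top,
              ENNReal.mul_lt_top (h1 K) ENNReal.coe_lt_top⟩)
  have e : ∀ x, ψ x * ∫ y, K (y - x) * g y = ∫ y, ψ x * (K (y - x) * g y) := fun x ↦
    (integral_const_mul _ _).symm
  simp_rw [e]
  refine ⟨hF.integral_prod_left, ?_⟩
  obtain ⟨w, hw, hw'⟩ := hS ψ
  rw [hw, (h w).2, integral_integral_swap hF]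
  refine integral_congr_ae (Filter.Eventually.of_forall fun y ↦ ?_)
  simp only [hw' y]
  rw [← integral_mul_const]
  simp only [mul_assoc]

/-! ### Fourier multipliers -/

/-- The Fourier transform of a product with an inverse Fourier transform is a convolution. -/
theorem fourier_mul_fourierInv_eq_integral (m ψ w : 𝓢(Rn n, ℂ))
    (hw : ∀ ξ, w ξ = m ξ * (𝓕⁻ ψ : 𝓢(Rn n, ℂ)) ξ) (y : Rn n) :
    (𝓕 w) y = ∫ x, ψ x * (𝓕 m) (y - x) := by
  set a : Rn n → ℂ := fun ξ ↦ Real.fourierChar (-inner ℝ ξ y) • m ξ with ha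
  have haint : Integrable a := by
    have := (VectorFourier.fourierIntegral_convergent_iff (μ := volume) Real.continuous_fourierChar
      (L := innerₗ (Rn n)) continuous_inner (f := m) y).2 m.integrable
    exact this
  -- The Fourier transform is moved from `ψ` to `a`, whose character produces the translation by
  -- `y`. The pairing carries a minus sign because the transform of `ψ` is the inverse one.
  have key := VectorFourier.integral_fourierIntegral_smul_eq_flip (μ := volume) (ν := volume)
    (L := -innerₗ (Rn n)) (f := ψ) (g := a) Real.continuous_fourierChar
    continuous_inner.neg ψ.integrable haint
  have e1 : (𝓕 w) y = ∫ ξ, (VectorFourier.fourierIntegral Real.fourierChar volume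
      (-innerₗ (Rn n)) ψ ξ) • a ξ := by
    rw [SchwartzMap.fourier_coe, Real.fourier_eq]
    refine integral_congr_ae (Filter.Eventually.of_forall fun ξ ↦ ?_)
    have e3 : (𝓕⁻ ψ : 𝓢(Rn n, ℂ)) ξ = VectorFourier.fourierIntegral Real.fourierChar volume
      (-innerₗ (Rn n)) ψ ξ := by rw [SchwartzMap.fourierInv_coe]; rfl
    simp only [hw, ha, e3, smul_eq_mul, Circle.smul_def]
    ring
  rw [e1, key]
  refine integral_congr_ae (Filter.Eventually.of_forall fun x ↦ ?_)
  simp only [smul_eq_mul]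
  congr 1
  rw [SchwartzMap.fourier_coe, Real.fourier_eq]
  refine integral_congr_ae (Filter.Eventually.of_forall fun ξ ↦ ?_)
  simp only [ha, smul_smul, ← AddChar.map_add_eq_mul]
  congr 2
  simp [inner_sub_right, real_inner_comm]
  ring

/-- The Fourier transform of a dilate. -/
theorem fourier_eq_of_dilation {m m' : 𝓢(Rn n, ℂ)} {t : ℝ} (ht : 0 < t) {c : ℂ}
    (h : ∀ ξ, m' ξ = c * m (t⁻¹ • ξ)) (y : Rn n) :
    (𝓕 m') y = c * ((t ^ n : ℝ) * (𝓕 m) (t • y)) := by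
  rw [SchwartzMap.fourier_coe, SchwartzMap.fourier_coe, Real.fourier_eq, Real.fourier_eq]
  have e : ∀ ξ : Rn n, Real.fourierChar (-inner ℝ ξ y) • m' ξ =
      c * (fun η ↦ Real.fourierChar (-inner ℝ η (t • y)) • m η) (t⁻¹ • ξ) := by
    intro ξ
    have : inner ℝ (t⁻¹ • ξ) (t • y) = inner ℝ ξ y := by
      rw [real_inner_smul_left, real_inner_smul_right, inv_mul_cancel_left₀ ht.ne']
    simp only [h, this, Circle.smul_def, smul_eq_mul]
    ring
  rw [integral_congr_ae (Filter.Eventually.of_forall e), integral_const_mul,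
    Measure.integral_comp_inv_smul_of_nonneg volume
      (fun η ↦ Real.fourierChar (-inner ℝ η (t • y)) • m η) ht.le]
  simp

/-! ### Block symbols divided by the symbol of `Λ^s` -/

theorem DyadicPartition.hasCompactSupport_symbol (𝒟 : DyadicPartition n) (j : ℤ) :
    HasCompactSupport (𝒟.symbol j) := by
  have hφ : HasCompactSupport 𝒟.φ :=
    HasCompactSupport.of_support_subset_isCompact (isCompact_closedBall (0 : Rn n) (8 / 3))
      fun x hx ↦ by simpa using (𝒟.φ_support (subset_tsupport _ hx)).2
  have h1 : HasCompactSupport fun ξ : Rn n ↦ 𝒟.φ (((2 : ℝ) ^ (-j) * (2 * Real.pi)) • ξ) :=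
    hφ.comp_smul (by positivity)
  have h2 := h1.comp_left (g := fun r : ℝ ↦ (r : ℂ)) (by simp)
  convert h2 using 1
  ext ξ
  simp [DyadicPartition.symbol, smul_smul]

theorem DyadicPartition.contDiff_symbol (𝒟 : DyadicPartition n) (j : ℤ) :
    ContDiff ℝ ∞ (𝒟.symbol j) :=
  Complex.ofRealCLM.contDiff.comp (𝒟.φ_smooth.comp
    (contDiff_id.const_smul (2 * Real.pi) |>.const_smul ((2 : ℝ) ^ (-j))))

/-- The symbol of a block, as a test function on `ℝⁿ ∖ {0}`. -/
def DyadicPartition.symbolTest (𝒟 : DyadicPartition n) (j : ℤ) : PuncturedTest n :=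
  ⟨(𝒟.hasCompactSupport_symbol j).toSchwartzMap (𝒟.contDiff_symbol j),
    𝒟.hasCompactSupport_symbol j, 𝒟.zero_notMem_tsupport_symbol j⟩

theorem DyadicPartition.symbolTest_apply (𝒟 : DyadicPartition n) (j : ℤ) (ξ : Rn n) :
    (𝒟.symbolTest j).1 ξ = 𝒟.symbol j ξ := rfl

theorem PuncturedTest.mulNormRpow_apply (s : ℝ) (ψ : PuncturedTest n) (ξ : Rn n) :
    (ψ.mulNormRpow s).1 ξ = (((2 * Real.pi * ‖ξ‖) ^ s : ℝ) : ℂ) * ψ.1 ξ := rfl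

theorem PuncturedTest.apply_zero (ψ : PuncturedTest n) : ψ.1 0 = 0 :=
  image_eq_zero_of_notMem_tsupport ψ.2.2

/-- The product of a test function on `ℝⁿ ∖ {0}` with a Schwartz function. -/
def PuncturedTest.mulSchwartz (m : PuncturedTest n) (η : 𝓢(Rn n, ℂ)) : PuncturedTest n :=
  ⟨SchwartzMap.smulLeftCLM ℂ m.1 η,
    m.2.1.mono' (subset_closure.trans fun _ hx ↦ (SchwartzMap.tsupport_smulLeftCLM_subset _ _ hx).2),
    fun h ↦ m.2.2 (SchwartzMap.tsupport_smulLeftCLM_subset _ _ h).2⟩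

theorem PuncturedTest.mulSchwartz_apply (m : PuncturedTest n) (η : 𝓢(Rn n, ℂ)) (ξ : Rn n) :
    (m.mulSchwartz η).1 ξ = m.1 ξ * η ξ :=
  SchwartzMap.smulLeftCLM_apply_apply m.1.hasTemperateGrowth η ξ

/-- The powers of `|2πξ|` cancel off the origin, and at the origin both sides vanish. It serves to
undo `Λ^s` when its defining identity is tested on a multiple of the symbol `|2πξ|^{-s} m`. -/
theorem PuncturedTest.mulNormRpow_mulSchwartz (m : PuncturedTest n) (s : ℝ) (η : 𝓢(Rn n, ℂ)) :
    (((m.mulNormRpow (-s)).mulSchwartz η).mulNormRpow s).1 = SchwartzMap.smulLeftCLM ℂ m.1 η := by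
  ext ξ
  rw [PuncturedTest.mulNormRpow_apply, PuncturedTest.mulSchwartz_apply,
    PuncturedTest.mulNormRpow_apply, SchwartzMap.smulLeftCLM_apply_apply m.1.hasTemperateGrowth]
  rcases eq_or_ne ξ 0 with rfl | hξ
  · simp [m.apply_zero]
  · have hpos : 0 < 2 * Real.pi * ‖ξ‖ := by have := norm_pos_iff.2 hξ; positivity
    have : (((2 * Real.pi * ‖ξ‖) ^ s : ℝ) : ℂ) * (((2 * Real.pi * ‖ξ‖) ^ (-s) : ℝ) : ℂ) = 1 := by
      rw [← Complex.ofReal_mul, ← Real.rpow_add hpos]; simp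
    rw [smul_eq_mul, ← mul_assoc, ← mul_assoc, this, one_mul]

/-- The symbols `φ(2^{-j} ξ) |ξ|^{-s}` are dilates of each other. -/
theorem DyadicPartition.symbolTest_mulNormRpow (𝒟 : DyadicPartition n) (s : ℝ) (j : ℤ) (ξ : Rn n) :
    ((𝒟.symbolTest j).mulNormRpow (-s)).1 ξ = (((2 : ℝ) ^ (-(j * s)) : ℝ) : ℂ) *
      ((𝒟.symbolTest 0).mulNormRpow (-s)).1 (((2 : ℝ) ^ j)⁻¹ • ξ) := by
  simp only [PuncturedTest.mulNormRpow_apply, DyadicPartition.symbolTest_apply,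
    DyadicPartition.symbol]
  have e1 : (2 : ℝ) ^ (-(0 : ℤ)) • (2 * Real.pi) • ((2 : ℝ) ^ j)⁻¹ • ξ =
      (2 : ℝ) ^ (-j) • (2 * Real.pi) • ξ := by
    simp only [smul_smul, zpow_neg, neg_zero, zpow_zero]
    congr 1
    ring
  have e2 : (2 * Real.pi * ‖ξ‖) ^ (-s) = (2 : ℝ) ^ (-(j * s)) *
      (2 * Real.pi * ‖((2 : ℝ) ^ j)⁻¹ • ξ‖) ^ (-s) := by
    have h2 : (2 : ℝ) ^ (-((j : ℝ) * s)) = ((2 : ℝ) ^ j) ^ (-s) := by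
      rw [← Real.rpow_intCast, ← Real.rpow_mul two_pos.le, mul_neg]
    rw [h2, norm_smul, norm_inv, Real.norm_of_nonneg (by positivity : (0 : ℝ) ≤ 2 ^ j),
      ← Real.mul_rpow (by positivity) (by positivity)]
    congr 1
    field_simp
  rw [e1, e2, Complex.ofReal_mul, mul_assoc]

/-- If `T` is in the class of `Λ^s f`, then `Δ_j f` is `T` convolved with a Schwartz function. -/
theorem IsFractionalLaplacian.block_apply {s : ℝ} {f : TemperedModPoly n} {T : 𝓢'(Rn n, ℂ)}
    (h : IsFractionalLaplacian s f ((polynomials n).mkQ T)) (𝒟 : DyadicPartition n) (j : ℤ)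
    (ψ : 𝓢(Rn n, ℂ)) :
    ∃ w : 𝓢(Rn n, ℂ), 𝒟.block j f ψ = T w ∧
      ∀ y, w y = ∫ x, ψ x * (𝓕 ((𝒟.symbolTest j).mulNormRpow (-s)).1) (y - x) := by
  obtain ⟨f, rfl⟩ := (polynomials n).mkQ_surjective f
  set w := ((𝒟.symbolTest j).mulNormRpow (-s)).mulSchwartz (𝓕⁻ ψ) with hw
  refine ⟨𝓕 w.1, ?_, fun y ↦ fourier_mul_fourierInv_eq_integral _ ψ _
    (fun ξ ↦ PuncturedTest.mulSchwartz_apply _ _ _) y⟩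
  -- This is the defining identity of `Λ^s f` tested on `w`.
  have h1 : T (𝓕 w.1) = f (𝓕 (w.mulNormRpow s).1) := h w
  rw [h1, hw, PuncturedTest.mulNormRpow_mulSchwartz]
  rfl

/-- If `g ∈ L¹ + L^∞` represents `Λ^s f`, then `Δ_j f` is a convolution with `g`. -/
theorem IsFractionalLaplacian.isRepresentedBy_block {s : ℝ} {f : TemperedModPoly n}
    {T : 𝓢'(Rn n, ℂ)} (hT : IsFractionalLaplacian s f ((polynomials n).mkQ T)) {g : Rn n → ℂ}
    (hg : IsRepresentedBy T g) {α : ℝ≥0}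
    (hα : ∫⁻ x, {x | (α : ℝ≥0∞) < ‖g x‖ₑ}.indicator (fun x ↦ ‖g x‖ₑ) x ≠ ⊤)
    (𝒟 : DyadicPartition n) (j : ℤ) :
    IsRepresentedBy (𝒟.block j f)
      (fun x ↦ ∫ y, (𝓕 ((𝒟.symbolTest j).mulNormRpow (-s)).1) (y - x) * g y) :=
  hg.convolution hα _ (hT.block_apply 𝒟 j)

/-! ### The embeddings -/

theorem two_rpow_eq_coe (r : ℝ) : (2 : ℝ≥0∞) ^ r = (((2 : ℝ≥0) ^ r : ℝ≥0) : ℝ≥0∞) := by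
  rw [ENNReal.coe_rpow_of_ne_zero two_ne_zero]; simp

theorem besovLorentzNorm_le_triebelLizorkinLorentzNorm (𝒟 : DyadicPartition n) (s : ℝ) (p : ℝ≥0∞)
    (f : TemperedModPoly n) :
    besovLorentzNorm 𝒟 s p f ≤ triebelLizorkinLorentzNorm 𝒟 s p f := by
  refine le_iInf₂ fun G hG ↦ iSup_le fun j ↦ ?_
  calc (2 : ℝ≥0∞) ^ ((j : ℝ) * s) * distWeakLorentzNorm p (𝒟.block j f)
      ≤ (2 : ℝ≥0∞) ^ ((j : ℝ) * s) * weakLorentzNorm p (fun x ↦ ‖G j x‖ₑ) := by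
        gcongr
        exact iInf₂_le (G j) (hG j)
    _ ≤ weakLorentzNorm p (fun x ↦ (2 : ℝ≥0∞) ^ ((j : ℝ) * s) * ‖G j x‖ₑ) := by
        rw [two_rpow_eq_coe]
        exact const_mul_weakLorentzNorm_le p (NNReal.rpow_pos two_pos).ne' _
    _ ≤ _ := weakLorentzNorm_mono p fun x ↦
        le_iSup (fun j : ℤ ↦ (2 : ℝ≥0∞) ^ ((j : ℝ) * s) * ‖G j x‖ₑ) j

theorem triebelLizorkinLorentzNorm_le_of_isRepresentedBy {𝒟 : DyadicPartition n} {s : ℝ}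
    {p : ℝ≥0∞} {f : TemperedModPoly n} {G : ℤ → Rn n → ℂ}
    (hG : ∀ j, IsRepresentedBy (𝒟.block j f) (G j)) :
    triebelLizorkinLorentzNorm 𝒟 s p f ≤
      weakLorentzNorm p (fun x ↦ ⨆ j : ℤ, (2 : ℝ≥0∞) ^ ((j : ℝ) * s) * ‖G j x‖ₑ) :=
  iInf₂_le G hG

/-- The weighted blocks of `f` are dominated by the maximal function of `Λ^s f`. -/
theorem exists_rpow_mul_enorm_integral_le (𝒟 : DyadicPartition n) (s : ℝ) :
    ∃ C : ℝ≥0, ∀ g : Rn n → ℂ, AEStronglyMeasurable g volume → ∀ (j : ℤ) (x : Rn n),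
      (2 : ℝ≥0∞) ^ ((j : ℝ) * s) *
        ‖∫ y, (𝓕 ((𝒟.symbolTest j).mulNormRpow (-s)).1) (y - x) * g y‖ₑ ≤
      C * maximalFunction (fun x ↦ ‖g x‖ₑ) x := by
  obtain ⟨C, hC⟩ :=
    exists_lintegral_dilation_le_maximalFunction (𝓕 ((𝒟.symbolTest 0).mulNormRpow (-s)).1)
  refine ⟨C, fun g hg j x ↦ ?_⟩
  generalize hc : (2 : ℝ≥0∞) ^ ((j : ℝ) * s) = c
  -- The weight `2^{js}` is exactly compensated by the factor `2^{-js}` from the homogeneity of the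
  -- symbol.
  have hcc : c * ENNReal.ofReal ((2 : ℝ) ^ (-((j : ℝ) * s))) = 1 := by
    rw [← ENNReal.ofReal_rpow_of_pos two_pos, ← hc, ENNReal.ofReal_ofNat,
      ← ENNReal.rpow_add _ _ two_ne_zero (by simp), add_neg_cancel, ENNReal.rpow_zero]
  have hdil := fourier_eq_of_dilation (t := (2 : ℝ) ^ j) (by positivity)
    (𝒟.symbolTest_mulNormRpow s j)
  generalize 𝓕 ((𝒟.symbolTest j).mulNormRpow (-s)).1 = K at hdil ⊢
  generalize 𝓕 ((𝒟.symbolTest 0).mulNormRpow (-s)).1 = K₀ at hdil hC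
  have e : ∀ r : ℝ, 0 ≤ r → ‖(r : ℂ)‖ₑ = ENNReal.ofReal r := fun r hr ↦ by
    rw [← ofReal_norm, Complex.norm_real, Real.norm_of_nonneg hr]
  have hK : ∀ y, ‖K (y - x) * g y‖ₑ = ENNReal.ofReal ((2 : ℝ) ^ (-((j : ℝ) * s))) *
      (ENNReal.ofReal (((2 : ℝ) ^ j) ^ n) * (‖K₀ ((2 : ℝ) ^ j • (y - x))‖ₑ * ‖g y‖ₑ)) := by
    intro y
    rw [hdil, enorm_mul, enorm_mul, enorm_mul, e _ (by positivity), e _ (by positivity)]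
    ring
  calc c * ‖∫ y, K (y - x) * g y‖ₑ
      ≤ c * ∫⁻ y, ‖K (y - x) * g y‖ₑ := by
        gcongr
        exact enorm_integral_le_lintegral_enorm _
    _ = c * ENNReal.ofReal ((2 : ℝ) ^ (-((j : ℝ) * s))) *
        (ENNReal.ofReal (((2 : ℝ) ^ j) ^ n) *
          ∫⁻ y, ‖K₀ ((2 : ℝ) ^ j • (y - x))‖ₑ * ‖g y‖ₑ) := by
        simp_rw [hK]
        rw [lintegral_const_mul' _ _ ENNReal.ofReal_ne_top,
          lintegral_const_mul' _ _ ENNReal.ofReal_ne_top, mul_assoc]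
    _ ≤ C * maximalFunction (fun x ↦ ‖g x‖ₑ) x := by
        rw [hcc, one_mul]
        exact hC _ hg.enorm _ (by positivity) x

theorem exists_triebelLizorkinLorentzNorm_le (hn : 0 < n) (𝒟 : DyadicPartition n) (s : ℝ)
    {p : ℝ≥0∞} (hp : 1 < p) :
    ∃ C : ℝ≥0, 0 < C ∧ ∀ f : TemperedModPoly n,
      triebelLizorkinLorentzNorm 𝒟 s p f ≤ C * sobolevLorentzNorm s p f := by
  obtain ⟨C₁, hC₁⟩ := exists_rpow_mul_enorm_integral_le 𝒟 s
  obtain ⟨C₂, hC₂⟩ := exists_weakLorentzNorm_maximalFunction_le hn hp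
  -- The inner `+ 1` makes the factor pulled out of the quasi-norm nonzero; the outer one makes the
  -- constant positive, so that it times `∞` is `∞`.
  have hC0 : (C₁ + 1) * C₂ + 1 ≠ 0 := by positivity
  refine ⟨(C₁ + 1) * C₂ + 1, by positivity, fun f ↦ ?_⟩
  -- With the constant moved to the left, the infima over `T` and `g` stand alone on the right and
  -- can be tested one `g` at a time.
  rw [mul_comm, ← ENNReal.div_le_iff_le_mul (Or.inl (ENNReal.coe_ne_zero.2 hC0))
    (Or.inl ENNReal.coe_ne_top)]
  refine le_iInf fun T ↦ le_iInf fun hT ↦ le_iInf fun g ↦ le_iInf fun hg ↦ ?_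
  rw [ENNReal.div_le_iff_le_mul (Or.inl (ENNReal.coe_ne_zero.2 hC0))
    (Or.inl ENNReal.coe_ne_top), mul_comm]
  have hgm := hg.aestronglyMeasurable
  have hut : ∀ x, ‖g x‖ₑ ≠ ⊤ := fun x ↦ enorm_ne_top
  rcases eq_or_ne (weakLorentzNorm p (fun x ↦ ‖g x‖ₑ)) ⊤ with htop | htop
  · rw [htop, ENNReal.mul_top (ENNReal.coe_ne_zero.2 hC0)]
    exact le_top
  obtain ⟨α, hα⟩ := exists_lintegral_indicator_ne_top hp hgm.enorm hut htop
  have hG := hT.isRepresentedBy_block hg hα 𝒟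
  refine (triebelLizorkinLorentzNorm_le_of_isRepresentedBy hG).trans ?_
  calc _ ≤ weakLorentzNorm p
          (fun x ↦ ((C₁ + 1 : ℝ≥0) : ℝ≥0∞) * maximalFunction (fun x ↦ ‖g x‖ₑ) x) := by
        refine weakLorentzNorm_mono p fun x ↦ iSup_le fun j ↦ (hC₁ g hgm j x).trans ?_
        gcongr
        exact le_self_add
    _ ≤ ((C₁ + 1 : ℝ≥0) : ℝ≥0∞) * weakLorentzNorm p (maximalFunction fun x ↦ ‖g x‖ₑ) :=
        weakLorentzNorm_const_mul_le p (by positivity) _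
    _ ≤ ((C₁ + 1 : ℝ≥0) : ℝ≥0∞) * (C₂ * weakLorentzNorm p (fun x ↦ ‖g x‖ₑ)) := by
        gcongr
        exact hC₂ _ hgm.enorm hut htop
    _ ≤ (((C₁ + 1) * C₂ + 1 : ℝ≥0) : ℝ≥0∞) * weakLorentzNorm p (fun x ↦ ‖g x‖ₑ) := by
        rw [← mul_assoc, ← ENNReal.coe_mul]
        gcongr
        exact le_self_add

end LorentzLP
end

theorem lemma2p5 (n : ℕ) (hn : 0 < n) (𝒟 : LorentzLP.DyadicPartition n) (s : ℝ)
    (p : ENNReal) (hp : 1 < p) :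
    ∃ C : NNReal, 0 < C ∧ ∀ f : LorentzLP.TemperedModPoly n,
      LorentzLP.besovLorentzNorm 𝒟 s p f ≤ LorentzLP.triebelLizorkinLorentzNorm 𝒟 s p f ∧
      LorentzLP.triebelLizorkinLorentzNorm 𝒟 s p f ≤
        (C : ENNReal) * LorentzLP.sobolevLorentzNorm s p f := by
  obtain ⟨C, hC, h⟩ := LorentzLP.exists_triebelLizorkinLorentzNorm_le hn 𝒟 s hp
  exact ⟨C, hC, fun f ↦
    ⟨LorentzLP.besovLorentzNorm_le_triebelLizorkinLorentzNorm 𝒟 s p f, h f⟩⟩
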